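/- Let $\mathbb T^3=(\mathbb R/\mathbb Z)^3$, $\Box=\partial_{x_1}^2-\partial_{x_2}^2-\partial_{x_3}^2$, and let $H^{1/2}(\mathbb T^3)$ be the space of $f\in L^2(\mathbb T^3)$ with $\|f\|_{H^{1/2}}^2=\sum_{k\in\mathbb Z^3}(1+|k|^2)^{1/2}|\hat f(k)|^2<\infty$. Fix a sign $\sigma\in\{1,-1\}$ and an (arbitrarily small) time $T>0$, and consider the cubic hyperbolic nonlinear Schrödinger equation $$ i\partial_t u+\Box u=\sigma|u|^2u\quad\text{on }[0,T]\times\mathbb T^3. $$ Suppose that $\Phi\colon H^{1/2}(\mathbb T^3)\to C([0,T];H^{1/2}(\mathbb T^3))$ extends the data-to-solution map on smooth data, i.e. $\Phi(u(0,\cdot))=u$ for every $C^\infty$ solution $u$ of the equation on $[0,T]\times\mathbb T^3$. Then $\Phi$ is not $C^3$ (in the real sense, for the norm of $H^{1/2}$ and the sup norm in time) at the origin. In particular, if the data-to-solution map on smooth data extends to a continuous map $H^{1/2}(\mathbb T^3)\to C([0,T];H^{1/2}(\mathbb T^3))$, then this extension is not $C^3$ at the origin. -/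

import Mathlib

open MeasureTheory
open scoped ContDiff

noncomputable section

namespace HNLS

/-- The torus `𝕋³ = (ℝ/ℤ)³`. -/
abbrev T3 : Type := UnitAddTorus (Fin 3)

/-- The Haar probability measure on `𝕋³`. -/
abbrev torusMeasure : Measure T3 := Measure.pi fun _ => AddCircle.haarAddCircle

/-- The covering map `ℝ³ → 𝕋³`. -/
def proj (x : Fin 3 → ℝ) : T3 := fun j => (x j : UnitAddCircle)

/-- The Japanese bracket `⟨k⟩ = √(1 + |k|²)` of a frequency, with `|k|` the Euclidean length. -/
def bracket (k : Fin 3 → ℤ) : ℝ := Real.sqrt (1 + ∑ j, (k j : ℝ) ^ 2)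

theorem bracket_pos (k : Fin 3 → ℤ) : 0 < bracket k :=
  Real.sqrt_pos.2 (by positivity)

/-- The Fourier coefficient `f̂(k) = ∫ f(x) e^{-2πi k·x} dx` as a linear functional on `L²(𝕋³)`. -/
def fourierCoeffL2 (k : Fin 3 → ℤ) : Lp ℂ 2 torusMeasure →ₗ[ℂ] ℂ where
  toFun f := UnitAddTorus.mFourierCoeff (f : T3 → ℂ) k
  map_add' f g := by
    have h (f : Lp ℂ 2 torusMeasure) : UnitAddTorus.mFourierCoeff (f : T3 → ℂ) k =
        (UnitAddTorus.mFourierBasis (d := Fin 3)).repr f k :=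
      (UnitAddTorus.mFourierBasis_repr (d := Fin 3) f k).symm
    rw [h, h, h, map_add]; rfl
  map_smul' c f := by
    have h (f : Lp ℂ 2 torusMeasure) : UnitAddTorus.mFourierCoeff (f : T3 → ℂ) k =
        (UnitAddTorus.mFourierBasis (d := Fin 3)).repr f k :=
      (UnitAddTorus.mFourierBasis_repr (d := Fin 3) f k).symm
    rw [h, h, map_smul]; rfl

theorem fourierCoeffL2_injective {f g : Lp ℂ 2 torusMeasure}
    (h : ∀ k, fourierCoeffL2 k f = fourierCoeffL2 k g) : f = g := by
  apply (UnitAddTorus.mFourierBasis (d := Fin 3)).repr.injective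
  ext k
  have e (f : Lp ℂ 2 torusMeasure) : fourierCoeffL2 k f =
      (UnitAddTorus.mFourierBasis (d := Fin 3)).repr f k :=
    (UnitAddTorus.mFourierBasis_repr (d := Fin 3) f k).symm
  have := h k
  rw [e, e] at this
  exact this

/-- The weighted Fourier coefficients `k ↦ ⟨k⟩^s f̂(k)`. -/
def weightedCoeff (s : ℝ) : Lp ℂ 2 torusMeasure →ₗ[ℂ] (Fin 3 → ℤ) → ℂ :=
  LinearMap.pi fun k => ((bracket k ^ s : ℝ) : ℂ) • fourierCoeffL2 k

theorem memℓp_weightedCoeff_iff (s : ℝ) (f : Lp ℂ 2 torusMeasure) :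
    Memℓp (weightedCoeff s f) 2 ↔
      Summable fun k : Fin 3 → ℤ =>
        bracket k ^ (2 * s) * ‖UnitAddTorus.mFourierCoeff (f : T3 → ℂ) k‖ ^ 2 := by
  rw [memℓp_gen_iff (by norm_num)]
  refine iff_of_eq (congrArg Summable (funext fun k => ?_))
  have hb := bracket_pos k
  simp only [weightedCoeff, LinearMap.pi_apply, LinearMap.smul_apply, norm_smul,
    Complex.norm_real, ENNReal.toReal_ofNat, Real.rpow_ofNat, mul_pow]
  rw [Real.norm_of_nonneg (by positivity), mul_comm 2 s, Real.rpow_mul hb.le, Real.rpow_two]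
  rfl

/-- The functions `f ∈ L²(𝕋³)` with `∑ₖ ⟨k⟩^{2s} |f̂(k)|² < ∞`, as a linear subspace. -/
def sobolevSubmodule (s : ℝ) : Submodule ℂ (Lp ℂ 2 torusMeasure) where
  carrier := {f | Summable fun k : Fin 3 → ℤ =>
    bracket k ^ (2 * s) * ‖UnitAddTorus.mFourierCoeff (f : T3 → ℂ) k‖ ^ 2}
  add_mem' {f g} hf hg := by
    simp only [Set.mem_ofPred_eq, ← memℓp_weightedCoeff_iff] at hf hg ⊢
    rw [map_add]; exact hf.add hg
  zero_mem' := by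
    simp only [Set.mem_ofPred_eq, ← memℓp_weightedCoeff_iff]
    rw [map_zero]; exact zero_memℓp
  smul_mem' c f hf := by
    simp only [Set.mem_ofPred_eq, ← memℓp_weightedCoeff_iff] at hf ⊢
    rw [map_smul]; exact hf.const_smul c

/-- The Sobolev space `H^s(𝕋³)`, a space of (classes of) functions; it carries the `H^s` norm and
not the norm of `L²`. -/
def Hs (s : ℝ) : Type := sobolevSubmodule s

namespace Hs

variable {s : ℝ}

instance : AddCommGroup (Hs s) := inferInstanceAs (AddCommGroup (sobolevSubmodule s))

instance : Module ℂ (Hs s) := inferInstanceAs (Module ℂ (sobolevSubmodule s))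

/-- The inclusion `H^s(𝕋³) → L²(𝕋³)`. -/
def toL2 : Hs s →ₗ[ℂ] Lp ℂ 2 torusMeasure := (sobolevSubmodule s).subtype

theorem toL2_injective : Function.Injective (toL2 (s := s)) :=
  (sobolevSubmodule s).injective_subtype

/-- The map `f ↦ (⟨k⟩^s f̂(k))ₖ` from `H^s(𝕋³)` to `ℓ²(ℤ³)`. -/
def toEll2 : Hs s →ₗ[ℂ] lp (fun _ : Fin 3 → ℤ => ℂ) 2 where
  toFun f := ⟨weightedCoeff s (toL2 f), (memℓp_weightedCoeff_iff s (toL2 f)).2 f.2⟩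
  map_add' f g := by ext k; simp [Pi.add_apply]; rfl
  map_smul' c f := by ext k; simp

theorem toEll2_injective : Function.Injective (toEll2 (s := s)) := by
  intro f g h
  apply toL2_injective
  apply fourierCoeffL2_injective
  intro k
  have hk : weightedCoeff s (toL2 f) k = weightedCoeff s (toL2 g) k :=
    congrFun (congrArg Subtype.val h) k
  have hb : ((bracket k ^ s : ℝ) : ℂ) ≠ 0 :=
    Complex.ofReal_ne_zero.2 (Real.rpow_pos_of_pos (bracket_pos k) s).ne'
  exact mul_left_cancel₀ hb hk

/-- The `H^s` norm, the `ℓ²` norm of `(⟨k⟩^s f̂(k))ₖ`; see `Hs.norm_eq`. -/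
instance : NormedAddCommGroup (Hs s) :=
  NormedAddCommGroup.induced (Hs s) (lp (fun _ : Fin 3 → ℤ => ℂ) 2) toEll2 toEll2_injective

instance : NormedSpace ℂ (Hs s) :=
  NormedSpace.induced ℂ (Hs s) (lp (fun _ : Fin 3 → ℤ => ℂ) 2) toEll2

theorem norm_eq (f : Hs s) :
    ‖f‖ = Real.sqrt (∑' k : Fin 3 → ℤ,
      bracket k ^ (2 * s) * ‖UnitAddTorus.mFourierCoeff (toL2 f : T3 → ℂ) k‖ ^ 2) := by
  change ‖toEll2 f‖ = _
  rw [lp.norm_eq_tsum_rpow (by norm_num), Real.sqrt_eq_rpow]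
  simp only [ENNReal.toReal_ofNat, Real.rpow_ofNat]
  congr 1
  refine tsum_congr fun k => ?_
  have hb := bracket_pos k
  change ‖((bracket k ^ s : ℝ) : ℂ) * UnitAddTorus.mFourierCoeff (toL2 f : T3 → ℂ) k‖ ^ 2 = _
  rw [norm_mul, Complex.norm_real, mul_pow, Real.norm_of_nonneg (by positivity), mul_comm 2 s,
    Real.rpow_mul hb.le, Real.rpow_two]

end Hs

/-- The second partial derivative `∂²f/∂x_j²` of a function on the torus. -/
def secondPartial (j : Fin 3) (f : T3 → ℂ) (x : T3) : ℂ :=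
  iteratedDeriv 2 (fun h : ℝ => f (x + proj (Pi.single j h))) 0

/-- The hyperbolic operator `□ = ∂²/∂x₁² - ∂²/∂x₂² - ∂²/∂x₃²` (coordinates are numbered from `0`
in the code). -/
def box (f : T3 → ℂ) (x : T3) : ℂ :=
  secondPartial 0 f x - secondPartial 1 f x - secondPartial 2 f x

/-- `u` is a smooth solution of `i ∂ₜu + □u = σ |u|² u` on `[0,T] × 𝕋³`: it is `C^∞` jointly in time
and space (up to the endpoints of the time interval) and solves the equation pointwise, with
one-sided time derivatives at the endpoints. Values of `u` at times outside `[0,T]` are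
irrelevant. -/
structure IsSmoothSolution (σ T : ℝ) (u : ℝ → T3 → ℂ) : Prop where
  smooth : ContDiffOn ℝ ∞ (fun p : ℝ × (Fin 3 → ℝ) => u p.1 (proj p.2))
    (Set.Icc 0 T ×ˢ Set.univ)
  equation : ∀ t ∈ Set.Icc 0 T, ∀ x : T3,
    Complex.I * derivWithin (fun τ => u τ x) (Set.Icc 0 T) t + box (u t) x =
      (σ : ℂ) * ((‖u t x‖ ^ 2 : ℝ) : ℂ) * u t x

/-- `Φ : H^s → C([0,T]; H^s)` extends the data-to-solution map `u(0) ↦ u` of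
`i ∂ₜu + □u = σ |u|² u` on smooth data: whenever `u` is a smooth solution on `[0,T]`,
`Φ` sends the initial datum `u(0)` to `u`. -/
def ExtendsSmoothFlow (σ T s : ℝ) (Φ : Hs s → C(Set.Icc (0 : ℝ) T, Hs s)) : Prop :=
  ∀ u : ℝ → T3 → ℂ, IsSmoothSolution σ T u →
    ∀ v : Hs s, (Hs.toL2 v : T3 → ℂ) =ᵐ[torusMeasure] u 0 →
      ∀ t : Set.Icc (0 : ℝ) T, (Hs.toL2 (Φ v t) : T3 → ℂ) =ᵐ[torusMeasure] u t

end HNLS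

end

noncomputable section

open Filter Topology Asymptotics

/-! A function of `x₁ + x₂` is killed by `□`, so on such data `g` the equation is an ODE at each
point, solved by `g * exp (-i σ t |g|²)`; the cubic term at time `T` is `-i σ T |g|² g`. If `Φ` were
`C³` at the origin, its third finite difference at `v` would be `O(‖v‖³)`; taking `v = ε g` and
letting `ε → 0` would give `‖|g|² g‖ ≤ C ‖g‖³` in `H^{1/2}`, with `C` independent of `g`
(`HNLS.exists_cubic_bound`).

This fails because `H^{1/2}` in one variable does not embed in `L^∞`. For `g = ∑_{n ≤ M} e^{2πi n
(x₁ + x₂)} / n` the squared norm is at most of order `log M`, whereas the coefficients of `|g|² g`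
are at least of order `(log m)² / m` over a long range of `m`, so its squared norm is at least of
order `(log M)⁵`, against the permitted `(log M)³` (`HNLS.log_le_of_cubic_bound`). -/

/-! ### Finite differences of `C^n` maps -/

theorem isBigO_norm_pow_succ_of_fderiv {E F : Type*} [NormedAddCommGroup E] [NormedSpace ℝ E]
    [NormedAddCommGroup F] [NormedSpace ℝ F] {g : E → F} {n : ℕ} (h0 : g 0 = 0)
    (hd : ∀ᶠ v in 𝓝 (0 : E), DifferentiableAt ℝ g v)
    (hO : fderiv ℝ g =O[𝓝 0] fun v => ‖v‖ ^ n) :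
    g =O[𝓝 0] fun v => ‖v‖ ^ (n + 1) := by
  obtain ⟨C, hC⟩ := hO.bound
  obtain ⟨r, hr, hball⟩ := Metric.eventually_nhds_iff_ball.1 (hd.and hC)
  refine IsBigO.of_bound C ?_
  filter_upwards [Metric.ball_mem_nhds (0 : E) hr] with v hv
  have hsub : ∀ w ∈ Metric.closedBall (0 : E) ‖v‖, w ∈ Metric.ball (0 : E) r := fun w hw => by
    simp only [Metric.mem_closedBall, Metric.mem_ball, dist_zero_right] at hw hv ⊢
    exact hw.trans_lt hv
  have hCnn : 0 ≤ C * ‖v‖ ^ n := by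
    have := (hball v hv).2
    rw [norm_pow, norm_norm] at this
    exact (norm_nonneg _).trans this
  have key := (convex_closedBall (0 : E) ‖v‖).norm_image_sub_le_of_norm_fderiv_le
    (f := g) (𝕜 := ℝ) (C := C * ‖v‖ ^ n) (x := 0) (y := v)
    (fun w hw => (hball w (hsub w hw)).1) (fun w hw => ?_) (by simp) (by simp)
  · rw [h0, sub_zero, sub_zero] at key
    simpa [pow_succ, mul_assoc] using key
  · have h1 := (hball w (hsub w hw)).2
    rw [norm_pow, norm_norm] at h1
    have hw' : ‖w‖ ≤ ‖v‖ := by simpa using hw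
    -- The big-O constant may be negative; the bound at `w` then forces `‖w‖ ^ n = 0`.
    rcases le_or_gt 0 C with hc | hc
    · exact h1.trans (by gcongr)
    · have : ‖w‖ ^ n = 0 := by
        by_contra hne
        have : 0 < ‖w‖ ^ n := lt_of_le_of_ne (by positivity) (Ne.symm hne)
        nlinarith [norm_nonneg (fderiv ℝ g w)]
      rw [this, mul_zero] at h1
      exact h1.trans hCnn

/-- A finite difference whose moments of order less than `n` vanish is `O(‖v‖ ^ n)` on functions
of class `C^n`. -/
theorem ContDiffAt.isBigO_finiteDifference {E : Type} [NormedAddCommGroup E] [NormedSpace ℝ E]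
    {ι : Type*} (s : Finset ι) (c : ι → ℝ) (n : ℕ) :
    ∀ {F : Type} [NormedAddCommGroup F] [NormedSpace ℝ F] {f : E → F} (_ : ContDiffAt ℝ n f 0)
      (a : ι → ℝ) (_ : ∀ k < n, ∑ i ∈ s, a i * c i ^ k = 0),
      (fun v => ∑ i ∈ s, a i • f (c i • v)) =O[𝓝 0] fun v => ‖v‖ ^ n := by
  have hc (i : ι) : Tendsto (fun v : E => c i • v) (𝓝 0) (𝓝 0) := by
    have : Continuous fun v : E => c i • v := by fun_prop
    simpa using this.tendsto 0
  induction n with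
  | zero =>
    intro F _ _ f hf a _
    simp only [pow_zero]
    have h1 : Tendsto (fun v => ∑ i ∈ s, a i • f (c i • v)) (𝓝 0)
        (𝓝 (∑ i ∈ s, a i • f 0)) :=
      tendsto_finsetSum _ fun i _ => ((hf.continuousAt.tendsto.comp (hc i)).const_smul (a i))
    exact h1.isBigO_one ℝ
  | succ n ih =>
    intro F _ _ f hf a ha
    have hd : ∀ᶠ v in 𝓝 (0 : E), DifferentiableAt ℝ f v := by
      have h1 : ContDiffAt ℝ 1 f 0 := hf.of_le (by exact_mod_cast Nat.le_add_left 1 n)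
      filter_upwards [h1.eventually (by simp)] with v hv
      exact hv.differentiableAt (by simp)
    have hd' : ∀ᶠ v in 𝓝 (0 : E), ∀ i ∈ s, DifferentiableAt ℝ f (c i • v) :=
      (Filter.eventually_all_finset s).2 fun i _ => (hc i).eventually hd
    have hder : ∀ᶠ v in 𝓝 (0 : E), HasFDerivAt (fun v => ∑ i ∈ s, a i • f (c i • v))
        (∑ i ∈ s, (a i * c i) • fderiv ℝ f (c i • v)) v := by
      filter_upwards [hd'] with v hv
      refine HasFDerivAt.fun_sum fun i hi => ?_
      have h2 := ((hv i hi).hasFDerivAt.comp v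
        ((hasFDerivAt_id v).const_smul (c i))).const_smul (a i)
      have h4 : (a i * c i) • fderiv ℝ f (c i • v) =
          a i • (fderiv ℝ f (c i • v)).comp (c i • ContinuousLinearMap.id ℝ E) := by
        ext w
        simp [mul_smul]
      rw [h4]
      exact h2
    refine isBigO_norm_pow_succ_of_fderiv ?_ (hder.mono fun v hv => hv.differentiableAt) ?_
    · have := ha 0 (Nat.succ_pos n)
      simp only [pow_zero, mul_one] at this
      simp only [smul_zero, ← Finset.sum_smul, this, zero_smul]
    -- Differentiating turns the weights `a i` into `a i * c i`, which shifts the moments by one.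
    -- The target becomes `E →L[ℝ] F`, hence the induction over all `F`.
    · have h3 := ih (f := fderiv ℝ f) (hf.fderiv_right (by norm_cast)) (fun i => a i * c i)
        fun k hk => by
          rw [← ha (k + 1) (by omega)]
          exact Finset.sum_congr rfl fun i _ => by ring
      refine h3.congr' ?_ EventuallyEq.rfl
      filter_upwards [hder] with v hv
      exact hv.fderiv.symm

namespace HNLS

/-! ### Explicit solutions constant along null planes -/

theorem contDiff_mFourier_proj (k : Fin 3 → ℤ) :
    ContDiff ℝ ∞ fun y : Fin 3 → ℝ => UnitAddTorus.mFourier k (proj y) := by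
  simp only [UnitAddTorus.mFourier, proj, ContinuousMap.coe_mk, fourier_coe_apply]
  refine contDiff_prod fun i _ => ?_
  have : ContDiff ℝ ∞ fun y : Fin 3 → ℝ => ((y i : ℝ) : ℂ) :=
    Complex.ofRealCLM.contDiff.comp (contDiff_apply ℝ ℝ i)
  fun_prop

/-- A function of `x₁ + x₂` alone is annihilated by `□`, so that it evolves by the ordinary
differential equation `i ∂ₜu = σ |u|² u`. -/
theorem isSmoothSolution_of_null {σ T : ℝ} (hT : 0 < T) {g : T3 → ℂ}
    (hg : ContDiff ℝ ∞ fun y : Fin 3 → ℝ => g (proj y))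
    (h01 : ∀ x h, g (x + proj (Pi.single 0 h)) = g (x + proj (Pi.single 1 h)))
    (h2 : ∀ x h, g (x + proj (Pi.single 2 h)) = g x) :
    IsSmoothSolution σ T fun t x =>
      g x * Complex.exp (-(Complex.I * ((σ * t * ‖g x‖ ^ 2 : ℝ) : ℂ))) where
  smooth := by
    apply ContDiff.contDiffOn
    have h1 : ContDiff ℝ ∞ fun p : ℝ × (Fin 3 → ℝ) => g (proj p.2) := hg.comp contDiff_snd
    have h3 : ContDiff ℝ ∞ fun p : ℝ × (Fin 3 → ℝ) => σ * p.1 * ‖g (proj p.2)‖ ^ 2 :=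
      (contDiff_const.mul contDiff_fst).mul (h1.norm_sq ℝ)
    have h4 : ContDiff ℝ ∞ fun p : ℝ × (Fin 3 → ℝ) =>
        ((σ * p.1 * ‖g (proj p.2)‖ ^ 2 : ℝ) : ℂ) := Complex.ofRealCLM.contDiff.comp h3
    exact h1.mul (Complex.contDiff_exp.comp (contDiff_const.mul h4).neg)
  equation t ht x := by
    have hb : box (fun x => g x *
        Complex.exp (-(Complex.I * ((σ * t * ‖g x‖ ^ 2 : ℝ) : ℂ)))) x = 0 := by
      simp only [box, secondPartial, h01, h2, sub_self]
      simp [iteratedDeriv_const]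
    have hd : HasDerivAt (fun τ : ℝ => g x *
        Complex.exp (-(Complex.I * ((σ * τ * ‖g x‖ ^ 2 : ℝ) : ℂ))))
        (g x * (Complex.exp (-(Complex.I * ((σ * t * ‖g x‖ ^ 2 : ℝ) : ℂ))) *
          -(Complex.I * ((σ * ‖g x‖ ^ 2 : ℝ) : ℂ)))) t := by
      have h5 : HasDerivAt (fun τ : ℝ => σ * τ * ‖g x‖ ^ 2) (σ * ‖g x‖ ^ 2) t := by
        simpa using ((hasDerivAt_id t).const_mul σ).mul_const (‖g x‖ ^ 2)
      exact ((h5.ofReal_comp.const_mul Complex.I).neg.cexp).const_mul (g x)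
    have hn : ‖Complex.exp (-(Complex.I * ((σ * t * ‖g x‖ ^ 2 : ℝ) : ℂ)))‖ = 1 := by
      rw [Complex.norm_exp]; simp [-Complex.ofReal_pow]
    rw [hb, hd.hasDerivWithinAt.derivWithin (uniqueDiffOn_Icc hT t ht), norm_mul, hn]
    push_cast
    linear_combination (-(σ : ℂ) * ‖g x‖ ^ 2 * g x *
      Complex.exp (-(Complex.I * (σ * t * ‖g x‖ ^ 2)))) * Complex.I_sq

/-! ### Trigonometric polynomials in `H^s` and their Fourier coefficients -/

/-- The element of `H^s` given by a continuous function with finitely many frequencies. -/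
def Hs.ofContinuous (s : ℝ) (g : C(T3, ℂ))
    (hg : (Function.support (UnitAddTorus.mFourierCoeff g)).Finite) : Hs s :=
  ⟨ContinuousMap.toLp (E := ℂ) 2 torusMeasure ℂ g, by
    refine summable_of_hasFiniteSupport (hg.subset fun k hk => ?_)
    rw [Function.mem_support] at hk ⊢
    intro h0
    apply hk
    have : UnitAddTorus.mFourierCoeff
        (ContinuousMap.toLp (E := ℂ) 2 torusMeasure ℂ g : T3 → ℂ) k = 0 :=
      (UnitAddTorus.mFourierCoeff_toLp (d := Fin 3) g k).trans h0
    rw [this]; simp⟩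

theorem Hs.coeff_ofContinuous (s : ℝ) (g : C(T3, ℂ))
    (hg : (Function.support (UnitAddTorus.mFourierCoeff g)).Finite) (k : Fin 3 → ℤ) :
    UnitAddTorus.mFourierCoeff (Hs.toL2 (Hs.ofContinuous s g hg) : T3 → ℂ) k =
      UnitAddTorus.mFourierCoeff g k :=
  UnitAddTorus.mFourierCoeff_toLp (d := Fin 3) g k

theorem Hs.toL2_smul_ofContinuous_ae (s : ℝ) (g : C(T3, ℂ))
    (hg : (Function.support (UnitAddTorus.mFourierCoeff g)).Finite) (ε : ℝ) :
    (Hs.toL2 (ε • Hs.ofContinuous s g hg) : T3 → ℂ) =ᵐ[torusMeasure] fun x => (ε : ℂ) * g x := by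
  have h1 : Hs.toL2 (ε • Hs.ofContinuous s g hg) =
      (ε : ℂ) • ContinuousMap.toLp (E := ℂ) 2 torusMeasure ℂ g :=
    map_smul Hs.toL2 (ε : ℂ) (Hs.ofContinuous s g hg)
  rw [h1]
  filter_upwards [Lp.coeFn_smul (ε : ℂ) (ContinuousMap.toLp (E := ℂ) 2 torusMeasure ℂ g),
    ContinuousMap.coeFn_toLp (𝕜 := ℂ) (p := 2) torusMeasure g] with x hx hx'
  rw [hx, Pi.smul_apply, hx', smul_eq_mul]

theorem Hs.sum_coeff_le_norm_sq (s : ℝ) (S : Finset (Fin 3 → ℤ)) (f : Hs s) :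
    ∑ k ∈ S, bracket k ^ (2 * s) * ‖fourierCoeffL2 k (Hs.toL2 f)‖ ^ 2 ≤ ‖f‖ ^ 2 := by
  have hnn : ∀ k : Fin 3 → ℤ,
      0 ≤ bracket k ^ (2 * s) * ‖UnitAddTorus.mFourierCoeff (Hs.toL2 f : T3 → ℂ) k‖ ^ 2 := by
    intro k
    have := bracket_pos k
    positivity
  rw [Hs.norm_eq, Real.sq_sqrt (tsum_nonneg hnn)]
  exact Summable.sum_le_tsum S (fun k _ => hnn k) f.2

/-- The Fourier coefficient as a linear functional on continuous functions. -/
def contCoeff (k : Fin 3 → ℤ) : C(T3, ℂ) →ₗ[ℂ] ℂ :=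
  fourierCoeffL2 k ∘ₗ (ContinuousMap.toLp (E := ℂ) 2 torusMeasure ℂ).toLinearMap

theorem contCoeff_apply (k : Fin 3 → ℤ) (g : C(T3, ℂ)) :
    contCoeff k g = UnitAddTorus.mFourierCoeff g k :=
  UnitAddTorus.mFourierCoeff_toLp (d := Fin 3) g k

theorem contCoeff_mFourier (k j : Fin 3 → ℤ) :
    contCoeff k (UnitAddTorus.mFourier j) = if j = k then 1 else 0 := by
  have h := orthonormal_iff_ite.1 (UnitAddTorus.orthonormal_mFourier (d := Fin 3)) k j
  simp only [ContinuousMap.inner_toLp, ← UnitAddTorus.mFourier_neg] at h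
  rw [contCoeff_apply]
  simp only [UnitAddTorus.mFourierCoeff, smul_eq_mul, eq_comm (a := j)]
  rw [← h]
  simp only [mul_comm]

theorem norm_contCoeff_le (k : Fin 3 → ℤ) (g : C(T3, ℂ)) : ‖contCoeff k g‖ ≤ ‖g‖ := by
  rw [contCoeff_apply]
  have h : ∀ x : T3, ‖UnitAddTorus.mFourier (-k) x • g x‖ ≤ ‖g‖ := fun x => by
    rw [norm_smul]
    have h1 := (UnitAddTorus.mFourier (-k)).norm_coe_le_norm x
    rw [UnitAddTorus.mFourier_norm] at h1
    exact (mul_le_of_le_one_left (norm_nonneg _) h1).trans (g.norm_coe_le_norm x)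
  have := norm_integral_le_of_norm_le_const (μ := torusMeasure) (Eventually.of_forall h)
  rw [probReal_univ, mul_one] at this
  exact this

/-! ### The cubic term of the flow -/

theorem continuous_wave (θ : ℝ) (g : C(T3, ℂ)) :
    Continuous fun x => g x * Complex.exp (-(Complex.I * ((θ * ‖g x‖ ^ 2 : ℝ) : ℂ))) := by
  fun_prop

/-- The value at the time with `σ t = θ` of the solution of `i ∂ₜu = σ |u|² u` with datum `g`. -/
def wave (θ : ℝ) (g : C(T3, ℂ)) : C(T3, ℂ) := ⟨_, continuous_wave θ g⟩

/-- Pointwise this is `|e^z - 1 - z| ≤ |z|²` for `|z| ≤ 1`, with `z = -iθ|g|²`. The sup norm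
suffices, since `g` stays fixed while its amplitude tends to zero. -/
theorem norm_wave_sub_le (θ : ℝ) (g : C(T3, ℂ)) (hg : |θ| * ‖g‖ ^ 2 ≤ 1) :
    ‖wave θ g - g + (Complex.I * (θ : ℂ)) • (g * g * star g)‖ ≤ θ ^ 2 * ‖g‖ ^ 5 := by
  refine (ContinuousMap.norm_le _ (by positivity)).2 fun x => ?_
  have hx := g.norm_coe_le_norm x
  set z : ℂ := -(Complex.I * ((θ * ‖g x‖ ^ 2 : ℝ) : ℂ)) with hz
  have hzn : ‖z‖ = |θ| * ‖g x‖ ^ 2 := by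
    rw [hz, norm_neg, norm_mul, Complex.norm_I, one_mul, Complex.norm_real, Real.norm_eq_abs,
      abs_mul, abs_of_nonneg (sq_nonneg ‖g x‖)]
  have hz1 : ‖z‖ ≤ |θ| * ‖g‖ ^ 2 := by rw [hzn]; gcongr
  have hmul : g x * (starRingEnd ℂ) (g x) = ((‖g x‖ ^ 2 : ℝ) : ℂ) := by
    rw [Complex.mul_conj, Complex.normSq_eq_norm_sq]
  have e : (wave θ g - g + (Complex.I * (θ : ℂ)) • (g * g * star g)) x =
      g x * (Complex.exp z - 1 - z) := by
    simp only [wave, ContinuousMap.add_apply, ContinuousMap.sub_apply, ContinuousMap.coe_mk,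
      ContinuousMap.smul_apply, ContinuousMap.mul_apply, ContinuousMap.star_apply, smul_eq_mul,
      ← starRingEnd_apply]
    rw [← hz]
    have hz2 : z = -(Complex.I * (θ * (g x * (starRingEnd ℂ) (g x)))) := by
      rw [hmul, hz]; push_cast; rfl
    clear_value z
    linear_combination g x * hz2
  rw [e, norm_mul]
  calc ‖g x‖ * ‖Complex.exp z - 1 - z‖ ≤ ‖g‖ * (|θ| * ‖g‖ ^ 2) ^ 2 := by
        refine mul_le_mul hx ?_ (norm_nonneg _) (norm_nonneg _)
        exact (Complex.norm_exp_sub_one_sub_id_le (hz1.trans hg)).trans (by gcongr)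
    _ = θ ^ 2 * ‖g‖ ^ 5 := by rw [mul_pow, sq_abs]; ring

theorem contCoeff_wave_isLittleO (θ : ℝ) (g : C(T3, ℂ)) (k : Fin 3 → ℤ) :
    (fun ε : ℝ => contCoeff k (wave θ ((ε : ℂ) • g)) - ε * contCoeff k g +
      Complex.I * θ * ε ^ 3 * contCoeff k (g * g * star g)) =o[𝓝 0] fun ε : ℝ => ε ^ 3 := by
  have hO : (fun ε : ℝ => contCoeff k (wave θ ((ε : ℂ) • g)) - ε * contCoeff k g +
      Complex.I * θ * ε ^ 3 * contCoeff k (g * g * star g)) =O[𝓝 0] fun ε : ℝ => ε ^ 5 := by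
    refine IsBigO.of_bound (θ ^ 2 * ‖g‖ ^ 5) ?_
    have hcont : Tendsto (fun ε : ℝ => |θ| * (|ε| * ‖g‖) ^ 2) (𝓝 0) (𝓝 0) := by
      have : Continuous fun ε : ℝ => |θ| * (|ε| * ‖g‖) ^ 2 := by fun_prop
      simpa using this.tendsto 0
    filter_upwards [hcont.eventually (ge_mem_nhds zero_lt_one)] with ε hε
    have hn : ‖(ε : ℂ) • g‖ = |ε| * ‖g‖ := by rw [norm_smul, Complex.norm_real, Real.norm_eq_abs]
    have h1 := (norm_contCoeff_le k _).trans (norm_wave_sub_le θ ((ε : ℂ) • g) (by rwa [hn]))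
    have e : ((ε : ℂ) • g) * ((ε : ℂ) • g) * star ((ε : ℂ) • g) =
        ((ε : ℂ) ^ 3) • (g * g * star g) := by
      ext x
      simp only [ContinuousMap.mul_apply, ContinuousMap.smul_apply, ContinuousMap.star_apply,
        smul_eq_mul, star_mul', Complex.star_def, Complex.conj_ofReal]
      ring
    rw [e, map_add, map_sub, map_smul, map_smul, map_smul, hn] at h1
    simp only [smul_eq_mul] at h1
    rw [norm_pow, Real.norm_eq_abs]
    have e1 : Complex.I * θ * ε ^ 3 * contCoeff k (g * g * star g) =
        Complex.I * θ * (ε ^ 3 * contCoeff k (g * g * star g)) := by ring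
    have e2 : θ ^ 2 * (|ε| * ‖g‖) ^ 5 = θ ^ 2 * ‖g‖ ^ 5 * |ε| ^ 5 := by rw [mul_pow]; ring
    rw [e1, ← e2]
    exact h1
  exact hO.trans_isLittleO (isLittleO_pow_pow (by norm_num))

/-- A finite difference of third order picks out the cubic term in the expansion of the solution
in the size of its datum. -/
theorem tendsto_finiteDifference_wave {ι : Type*} (S : Finset ι) (a c : ι → ℝ) (θ : ℝ)
    (h1 : ∑ i ∈ S, a i * c i = 0) (g : C(T3, ℂ)) (k : Fin 3 → ℤ) :
    Tendsto (fun ε : ℝ => ((ε ^ 3 : ℝ) : ℂ)⁻¹ *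
      ∑ i ∈ S, (a i : ℂ) * contCoeff k (wave θ (((c i * ε : ℝ) : ℂ) • g))) (𝓝[≠] 0)
      (𝓝 (-(Complex.I * θ * (∑ i ∈ S, a i * c i ^ 3 : ℝ) * contCoeff k (g * g * star g)))) := by
  set R : ℝ → ℂ := fun ε : ℝ => contCoeff k (wave θ ((ε : ℂ) • g)) - ε * contCoeff k g +
      Complex.I * θ * ε ^ 3 * contCoeff k (g * g * star g) with hR
  have hRo : R =o[𝓝 0] fun ε : ℝ => ε ^ 3 := contCoeff_wave_isLittleO θ g k
  have hRc : ∀ i, (fun ε : ℝ => R (c i * ε)) =o[𝓝 0] fun ε : ℝ => ε ^ 3 := fun i => by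
    have ht : Tendsto (fun ε : ℝ => c i * ε) (𝓝 0) (𝓝 0) := by
      have : Continuous fun ε : ℝ => c i * ε := by fun_prop
      simpa using this.tendsto 0
    refine (hRo.comp_tendsto ht).trans_isBigO ?_
    refine IsBigO.of_bound (|c i| ^ 3) (Eventually.of_forall fun ε => ?_)
    simp [mul_pow]
  have hsum : (fun ε : ℝ => ∑ i ∈ S, (a i : ℂ) * R (c i * ε)) =o[𝓝 0] fun ε : ℝ => ε ^ 3 :=
    IsLittleO.fun_sum fun i _ => (hRc i).const_mul_left _
  have hlim : Tendsto (fun ε : ℝ => ((ε ^ 3 : ℝ) : ℂ)⁻¹ * ∑ i ∈ S, (a i : ℂ) * R (c i * ε))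
      (𝓝[≠] 0) (𝓝 0) := by
    have := (hsum.mono nhdsWithin_le_nhds (l := 𝓝[≠] 0)).tendsto_inv_smul_nhds_zero
    refine this.congr fun ε => ?_
    rw [← Complex.ofReal_inv]
    rfl
  have h2 := hlim.add_const
    (-(Complex.I * θ * (∑ i ∈ S, a i * c i ^ 3 : ℝ) * contCoeff k (g * g * star g)))
  rw [zero_add] at h2
  refine h2.congr' ?_
  filter_upwards [self_mem_nhdsWithin] with ε hε
  have hε0 : (ε : ℂ) ≠ 0 := Complex.ofReal_ne_zero.2 hε
  have h1' : ∑ i ∈ S, (a i : ℂ) * c i = 0 := by exact_mod_cast congrArg ((↑) : ℝ → ℂ) h1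
  -- The expansion has no constant or quadratic term, so only the first moment has to vanish.
  have e : ∑ i ∈ S, (a i : ℂ) * R (c i * ε) =
      ∑ i ∈ S, (a i : ℂ) * contCoeff k (wave θ (((c i * ε : ℝ) : ℂ) • g)) -
      (∑ i ∈ S, (a i : ℂ) * c i) * (ε * contCoeff k g) +
      (∑ i ∈ S, (a i : ℂ) * c i ^ 3) *
        (Complex.I * θ * ε ^ 3 * contCoeff k (g * g * star g)) := by
    simp only [hR]
    rw [Finset.sum_mul, Finset.sum_mul, ← Finset.sum_sub_distrib, ← Finset.sum_add_distrib]
    refine Finset.sum_congr rfl fun i _ => ?_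
    push_cast
    ring
  rw [e, h1']
  push_cast
  field_simp
  ring

/-- If the flow is `C³` at the origin, then its cubic term at data depending on `x₁ + x₂` alone is
controlled by the cube of the norm of the datum, uniformly in the datum. -/
theorem exists_cubic_bound {σ T s : ℝ} (hσ : σ = 1 ∨ σ = -1) (hT : 0 < T)
    (Φ : Hs s → C(Set.Icc (0 : ℝ) T, Hs s)) (hΦ : ExtendsSmoothFlow σ T s Φ)
    (hreg : ContDiffAt ℝ 3 Φ 0) :
    ∃ C : ℝ, ∀ (g : C(T3, ℂ)) (hfin : (Function.support (UnitAddTorus.mFourierCoeff g)).Finite),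
      (ContDiff ℝ ∞ fun y : Fin 3 → ℝ => g (proj y)) →
      (∀ x h, g (x + proj (Pi.single 0 h)) = g (x + proj (Pi.single 1 h))) →
      (∀ x h, g (x + proj (Pi.single 2 h)) = g x) →
      ∀ S : Finset (Fin 3 → ℤ),
        ∑ k ∈ S, bracket k ^ (2 * s) * (T * ‖contCoeff k (g * g * star g)‖) ^ 2 ≤
          C * (‖Hs.ofContinuous s g hfin‖ ^ 2) ^ 3 := by
  -- The third forward difference: moments 0, 1, 2 vanish and the third is 6. Squaring gives the 36
  -- below.
  let a : Fin 4 → ℝ := ![-1, 3, -3, 1]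
  let c : Fin 4 → ℝ := ![0, 1, 2, 3]
  have hO := ContDiffAt.isBigO_finiteDifference Finset.univ c 3 hreg a (by
    intro k hk
    interval_cases k <;> simp [Fin.sum_univ_four, a, c] <;> norm_num)
  obtain ⟨C, hC⟩ := hO.bound
  refine ⟨C ^ 2 / 36, fun g hfin hg h01 h2 S => ?_⟩
  set V := Hs.ofContinuous s g hfin with hV
  let τ : Set.Icc (0 : ℝ) T := ⟨T, hT.le, le_rfl⟩
  have hflow : ∀ (δ : ℝ) (k : Fin 3 → ℤ),
      fourierCoeffL2 k (Hs.toL2 (Φ (δ • V) τ)) = contCoeff k (wave (σ * T) ((δ : ℂ) • g)) := by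
    intro δ k
    have hsol := isSmoothSolution_of_null (σ := σ) hT (g := fun x => (δ : ℂ) * g x)
      (contDiff_const.mul hg) (fun x h => by rw [h01]) (fun x h => by rw [h2])
    have h3 := hΦ _ hsol (δ • V) (by
      refine (Hs.toL2_smul_ofContinuous_ae s g hfin δ).trans (Eventually.of_forall fun x => ?_)
      simp) τ
    rw [contCoeff_apply]
    exact integral_congr_ae (h3.mono fun x hx => by
      simp only [hx]; rfl)
  have hεV : Tendsto (fun ε : ℝ => ε • V) (𝓝[≠] 0) (𝓝 0) := by
    have : Continuous fun ε : ℝ => ε • V := by fun_prop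
    simpa using (this.tendsto 0).mono_left nhdsWithin_le_nhds
  let D : ℝ → Hs s := fun ε => (∑ i, a i • Φ (c i • ε • V)) τ
  have hDcoeff : ∀ (ε : ℝ) (k : Fin 3 → ℤ), fourierCoeffL2 k (Hs.toL2 (D ε)) =
      ∑ i, (a i : ℂ) * contCoeff k (wave (σ * T) (((c i * ε : ℝ) : ℂ) • g)) := by
    intro ε k
    have h4 : D ε = ∑ i, (a i : ℂ) • Φ ((c i * ε) • V) τ := by
      simp only [D, ContinuousMap.sum_apply, mul_smul]
      rfl
    rw [h4, map_sum, map_sum]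
    simp only [map_smul, hflow, smul_eq_mul]
  -- How small `ε` must be depends on `g`, but `C` does not. The finite set `S` lets the limit be
  -- taken term by term.
  have hbound : ∀ᶠ ε : ℝ in 𝓝[≠] 0,
      ∑ k ∈ S, bracket k ^ (2 * s) * ‖((ε ^ 3 : ℝ) : ℂ)⁻¹ *
        ∑ i, (a i : ℂ) * contCoeff k (wave (σ * T) (((c i * ε : ℝ) : ℂ) • g))‖ ^ 2 ≤
      C ^ 2 * (‖V‖ ^ 2) ^ 3 := by
    filter_upwards [hεV.eventually hC, self_mem_nhdsWithin] with ε hε hε0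
    have hε0' : 0 < |ε| := abs_pos.2 hε0
    have h5 : ‖D ε‖ ≤ C * (|ε| * ‖V‖) ^ 3 := by
      refine (ContinuousMap.norm_coe_le_norm _ τ).trans ?_
      simpa [norm_smul] using hε
    have h6 := Hs.sum_coeff_le_norm_sq s S (D ε)
    simp only [hDcoeff] at h6
    have h7 : ‖D ε‖ ^ 2 ≤ (C * (|ε| * ‖V‖) ^ 3) ^ 2 := by gcongr
    have h8 : ∀ z : ℂ, ‖((ε ^ 3 : ℝ) : ℂ)⁻¹ * z‖ ^ 2 = (|ε| ^ 6)⁻¹ * ‖z‖ ^ 2 := fun z => by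
      rw [norm_mul, norm_inv, Complex.norm_real, norm_pow, Real.norm_eq_abs, mul_pow, inv_pow,
        ← pow_mul]
    simp only [h8, mul_left_comm _ (|ε| ^ 6)⁻¹]
    rw [← Finset.mul_sum, inv_mul_le_iff₀ (by positivity)]
    refine (h6.trans h7).trans_eq ?_
    ring
  have hlim : Tendsto (fun ε : ℝ => ∑ k ∈ S, bracket k ^ (2 * s) * ‖((ε ^ 3 : ℝ) : ℂ)⁻¹ *
        ∑ i, (a i : ℂ) * contCoeff k (wave (σ * T) (((c i * ε : ℝ) : ℂ) • g))‖ ^ 2) (𝓝[≠] 0)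
      (𝓝 (∑ k ∈ S, bracket k ^ (2 * s) * (36 * (T * ‖contCoeff k (g * g * star g)‖) ^ 2))) := by
    refine tendsto_finsetSum _ fun k _ => Tendsto.const_mul _ ?_
    have h9 := (tendsto_finiteDifference_wave Finset.univ a c (σ * T)
      (by simp [Fin.sum_univ_four, a, c]; norm_num) g k).norm.pow 2
    convert h9 using 2
    have h10 : ∑ i, a i * c i ^ 3 = 6 := by simp [Fin.sum_univ_four, a, c]; norm_num
    have h11 : ‖((σ * T : ℝ) : ℂ)‖ = T := by
      rw [Complex.norm_real, Real.norm_eq_abs, abs_mul, abs_of_pos hT]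
      rcases hσ with rfl | rfl <;> simp
    rw [h10, norm_neg, norm_mul, norm_mul, norm_mul, h11, Complex.norm_I]
    simp only [Complex.norm_real]
    norm_num
    ring
  have hfinal := le_of_tendsto hlim hbound
  simp only [mul_left_comm _ (36 : ℝ)] at hfinal
  rw [← Finset.mul_sum] at hfinal
  linarith

/-! ### The truncated logarithm and its cube -/

/-- The frequency `(n, n, 0)` on the light cone. -/
def nullFreq (n : ℤ) : Fin 3 → ℤ := ![n, n, 0]

theorem nullFreq_injective : Function.Injective nullFreq := fun m n h => by
  simpa [nullFreq] using congrFun h 0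

theorem nullFreq_add_sub (a b c : ℤ) :
    nullFreq a + nullFreq b + -nullFreq c = nullFreq (a + b - c) := by
  ext i; fin_cases i <;> simp [nullFreq, sub_eq_add_neg]

theorem mFourier_nullFreq_apply (n : ℤ) (x : T3) :
    UnitAddTorus.mFourier (nullFreq n) x = fourier n (x 0 + x 1) := by
  simp only [UnitAddTorus.mFourier, nullFreq, ContinuousMap.coe_mk, Fin.prod_univ_three]
  simp [fourier_apply, AddCircle.toCircle_add, smul_add]

theorem le_bracket_nullFreq (n : ℕ) : (n : ℝ) ≤ bracket (nullFreq n) := by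
  refine Real.le_sqrt_of_sq_le ?_
  simp only [nullFreq, Fin.sum_univ_three]
  simp
  nlinarith [sq_nonneg (n : ℝ)]

theorem bracket_nullFreq_le {n : ℕ} (hn : 1 ≤ n) : bracket (nullFreq n) ≤ 2 * n := by
  have h1 : (1 : ℝ) ≤ n := by exact_mod_cast hn
  refine Real.sqrt_le_iff.2 ⟨by positivity, ?_⟩
  simp only [nullFreq, Fin.sum_univ_three]
  simp
  nlinarith

/-- The trigonometric polynomial `∑_{n ≤ M} e^{2πi n (x₁ + x₂)} / n`, a truncated logarithm. -/
def logPoly (M : ℕ) : C(T3, ℂ) :=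
  ∑ n ∈ Finset.Icc 1 M, ((n : ℂ)⁻¹) • UnitAddTorus.mFourier (nullFreq n)

theorem logPoly_apply (M : ℕ) (x : T3) :
    logPoly M x = ∑ n ∈ Finset.Icc 1 M, (n : ℂ)⁻¹ * fourier (n : ℤ) (x 0 + x 1) := by
  simp [logPoly, ContinuousMap.sum_apply, mFourier_nullFreq_apply]

theorem contDiff_logPoly (M : ℕ) : ContDiff ℝ ∞ fun y : Fin 3 → ℝ => logPoly M (proj y) := by
  simp only [logPoly, ContinuousMap.sum_apply, ContinuousMap.smul_apply]
  exact ContDiff.sum fun n _ => (contDiff_mFourier_proj _).const_smul _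

theorem logPoly_add_single_zero (M : ℕ) (x : T3) (h : ℝ) :
    logPoly M (x + proj (Pi.single 0 h)) = logPoly M (x + proj (Pi.single 1 h)) := by
  simp [logPoly_apply, proj, add_assoc, add_comm (h : UnitAddCircle)]

theorem logPoly_add_single_two (M : ℕ) (x : T3) (h : ℝ) :
    logPoly M (x + proj (Pi.single 2 h)) = logPoly M x := by
  simp [logPoly_apply, proj]

theorem contCoeff_logPoly (M : ℕ) (k : Fin 3 → ℤ) :
    contCoeff k (logPoly M) =
      ∑ n ∈ Finset.Icc 1 M, (n : ℂ)⁻¹ * if nullFreq n = k then 1 else 0 := by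
  simp only [logPoly, map_sum, map_smul, contCoeff_mFourier, smul_eq_mul]

theorem contCoeff_logPoly_eq_zero {M : ℕ} {k : Fin 3 → ℤ}
    (hk : k ∉ (Finset.Icc 1 M).image fun n : ℕ => nullFreq n) : contCoeff k (logPoly M) = 0 := by
  rw [contCoeff_logPoly]
  refine Finset.sum_eq_zero fun n hn => ?_
  rw [if_neg fun h => hk (Finset.mem_image.2 ⟨n, hn, h⟩), mul_zero]

theorem contCoeff_nullFreq_logPoly {M n : ℕ} (hn : n ∈ Finset.Icc 1 M) :
    contCoeff (nullFreq n) (logPoly M) = (n : ℂ)⁻¹ := by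
  rw [contCoeff_logPoly, Finset.sum_eq_single_of_mem n hn]
  · simp
  · intro j _ hj
    rw [if_neg fun h => hj (by exact_mod_cast nullFreq_injective h), mul_zero]

theorem finite_support_logPoly (M : ℕ) :
    (Function.support (UnitAddTorus.mFourierCoeff (logPoly M))).Finite := by
  refine ((Finset.Icc 1 M).image fun n : ℕ => nullFreq n).finite_toSet.subset fun k hk => ?_
  by_contra h
  exact hk ((contCoeff_apply k _).symm.trans (contCoeff_logPoly_eq_zero h))

theorem norm_sq_logPoly_le (M : ℕ) :
    ‖Hs.ofContinuous (1 / 2) (logPoly M) (finite_support_logPoly M)‖ ^ 2 ≤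
      2 * ∑ n ∈ Finset.Icc 1 M, (n : ℝ)⁻¹ := by
  have hnn : ∀ k : Fin 3 → ℤ, 0 ≤ bracket k ^ (2 * (1 / 2 : ℝ)) *
      ‖UnitAddTorus.mFourierCoeff (Hs.toL2 (Hs.ofContinuous (1 / 2) (logPoly M)
        (finite_support_logPoly M)) : T3 → ℂ) k‖ ^ 2 := fun k => by
    have := bracket_pos k
    positivity
  rw [Hs.norm_eq, Real.sq_sqrt (tsum_nonneg hnn)]
  simp only [Hs.coeff_ofContinuous, ← contCoeff_apply]
  rw [tsum_eq_sum (s := (Finset.Icc 1 M).image fun n : ℕ => nullFreq n)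
    fun k hk => by simp [contCoeff_logPoly_eq_zero hk],
    Finset.sum_image fun a _ b _ h => by exact_mod_cast nullFreq_injective h, Finset.mul_sum]
  refine Finset.sum_le_sum fun n hn => ?_
  have hn1 := (Finset.mem_Icc.1 hn).1
  have hn0 : (0 : ℝ) < n := by exact_mod_cast hn1
  rw [contCoeff_nullFreq_logPoly hn, norm_inv, Complex.norm_natCast,
    show (2 * (1 / 2) : ℝ) = 1 by norm_num, Real.rpow_one]
  calc bracket (nullFreq n) * (n : ℝ)⁻¹ ^ 2 ≤ 2 * n * (n : ℝ)⁻¹ ^ 2 := by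
        gcongr; exact bracket_nullFreq_le hn1
    _ = 2 * (n : ℝ)⁻¹ := by field_simp

theorem contCoeff_cubic_logPoly (M : ℕ) (m : ℤ) :
    contCoeff (nullFreq m) (logPoly M * logPoly M * star (logPoly M)) =
      ((∑ b ∈ Finset.Icc 1 M, ∑ c ∈ Finset.Icc 1 M, ∑ a ∈ Finset.Icc 1 M,
        (a : ℝ)⁻¹ * (b : ℝ)⁻¹ * (c : ℝ)⁻¹ * (if (a + b - c : ℤ) = m then 1 else 0) : ℝ) : ℂ) := by
  have e : logPoly M * logPoly M * star (logPoly M) =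
      ∑ b ∈ Finset.Icc 1 M, ∑ c ∈ Finset.Icc 1 M, ∑ a ∈ Finset.Icc 1 M,
        (((a : ℝ)⁻¹ * (b : ℝ)⁻¹ * (c : ℝ)⁻¹ : ℝ) : ℂ) •
          UnitAddTorus.mFourier (nullFreq (a + b - c)) := by
    ext x
    simp only [← nullFreq_add_sub, ContinuousMap.mul_apply, ContinuousMap.star_apply, logPoly,
      ContinuousMap.sum_apply, ContinuousMap.smul_apply, UnitAddTorus.mFourier_add,
      UnitAddTorus.mFourier_neg, smul_eq_mul, star_sum, star_mul', Complex.star_def, map_inv₀,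
      map_natCast]
    rw [Finset.sum_mul_sum, Finset.sum_comm, Finset.sum_mul]
    refine Finset.sum_congr rfl fun b _ => ?_
    rw [Finset.sum_mul_sum, Finset.sum_comm]
    refine Finset.sum_congr rfl fun c _ => Finset.sum_congr rfl fun a _ => ?_
    push_cast
    ring
  rw [e]
  simp only [map_sum, map_smul, contCoeff_mFourier, smul_eq_mul, nullFreq_injective.eq_iff]
  push_cast [apply_ite ((↑) : ℝ → ℂ)]
  rfl

/-- The `m`-th frequency of `|P|² P`, for `P` the truncated logarithm, has a coefficient of order
`(log m)² / m`. -/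
theorem le_norm_contCoeff_cubic_logPoly {K M m : ℕ} (hKm : K ≤ m) (hmM : 2 * m ≤ M) (hm : 1 ≤ m) :
    (2 * (m : ℝ))⁻¹ * (∑ n ∈ Finset.Icc 1 K, (n : ℝ)⁻¹) ^ 2 ≤
      ‖contCoeff (nullFreq m) (logPoly M * logPoly M * star (logPoly M))‖ := by
  rw [contCoeff_cubic_logPoly, Complex.norm_real]
  refine le_trans ?_ (le_abs_self _)
  -- All terms are nonnegative, so it is enough to keep `b, c ≤ K` and the single `a = m + c - b`.
  -- Since `K ≤ m`, this `a` lies in `[1, 2m]`, and `a⁻¹ ≥ (2m)⁻¹`.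
  have hsub : Finset.Icc 1 K ⊆ Finset.Icc 1 M := Finset.Icc_subset_Icc le_rfl (by omega)
  rw [sq, Finset.sum_mul_sum, Finset.mul_sum]
  refine (Finset.sum_le_sum fun b hb => ?_).trans
    (Finset.sum_le_sum_of_subset_of_nonneg hsub fun b _ _ => by positivity)
  rw [Finset.mul_sum]
  refine (Finset.sum_le_sum fun c hc => ?_).trans
    (Finset.sum_le_sum_of_subset_of_nonneg hsub fun c _ _ => by positivity)
  rw [Finset.mem_Icc] at hb hc
  refine le_trans ?_ (Finset.single_le_sum (a := m + c - b) (fun a _ => by positivity)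
    (Finset.mem_Icc.2 ⟨by omega, by omega⟩))
  have h1 : (((m + c - b : ℕ) : ℤ) + b - c : ℤ) = m := by omega
  have h2 : ((m + c - b : ℕ) : ℝ) ≤ 2 * m := by
    have : m + c - b ≤ 2 * m := by omega
    exact_mod_cast this
  have h3 : (0 : ℝ) < ((m + c - b : ℕ) : ℝ) := by
    have : 0 < m + c - b := by omega
    exact_mod_cast this
  rw [if_pos h1, mul_one, mul_assoc]
  gcongr

/-! ### Harmonic sums and the failure of the cubic bound -/

theorem log_le_sum_inv (n : ℕ) (hn : 1 ≤ n) :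
    Real.log n ≤ ∑ i ∈ Finset.Icc 1 n, (i : ℝ)⁻¹ := by
  have h := log_add_one_le_harmonic n
  rw [harmonic_eq_sum_Icc] at h
  push_cast at h
  have hn0 : (0 : ℝ) < n := by exact_mod_cast hn
  exact (Real.log_le_log hn0 (by linarith)).trans h

theorem sum_inv_le_one_add_log (n : ℕ) :
    ∑ i ∈ Finset.Icc 1 n, (i : ℝ)⁻¹ ≤ 1 + Real.log n := by
  have h := harmonic_le_one_add_log n
  rw [harmonic_eq_sum_Icc] at h
  push_cast at h
  exact h

theorem log_sub_one_le_sum_Ioc_inv {K : ℕ} (hK : 1 ≤ K) :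
    Real.log K - 1 ≤ ∑ m ∈ Finset.Ioc K (K ^ 2), (m : ℝ)⁻¹ := by
  have hle : K ≤ K ^ 2 := by nlinarith
  have h : ∑ m ∈ Finset.Icc 1 K, (m : ℝ)⁻¹ + ∑ m ∈ Finset.Ioc K (K ^ 2), (m : ℝ)⁻¹ =
      ∑ m ∈ Finset.Icc 1 (K ^ 2), (m : ℝ)⁻¹ :=
    Finset.sum_Ioc_consecutive (fun m : ℕ => (m : ℝ)⁻¹) (Nat.zero_le K) hle
  have h1 := sum_inv_le_one_add_log K
  have h2 := log_le_sum_inv (K ^ 2) (hK.trans hle)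
  push_cast at h2
  rw [Real.log_pow] at h2
  push_cast at h2
  linarith

theorem sum_inv_two_mul_sq_le {K : ℕ} (hK : 1 ≤ K) :
    ∑ n ∈ Finset.Icc (1 : ℕ) (2 * K ^ 2), (n : ℝ)⁻¹ ≤ 2 + 2 * Real.log K := by
  have h := sum_inv_le_one_add_log (2 * K ^ 2)
  have hK0 : (K : ℝ) ≠ 0 := by positivity
  push_cast at h
  rw [Real.log_mul two_ne_zero (pow_ne_zero 2 hK0), Real.log_pow] at h
  push_cast at h
  linarith [Real.log_two_lt_d9]

/-- The map `f ↦ |f|² f` is not bounded on `H^{1/2}`: its value at the truncated logarithm has a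
norm squared of order `(log K)⁵`, as against `(log K)³` for a bounded cubic map. -/
theorem log_le_of_cubic_bound {T C : ℝ} (hT : 0 < T) {K : ℕ} (hK : 1 ≤ Real.log K)
    (h : ∀ S : Finset (Fin 3 → ℤ),
      ∑ k ∈ S, bracket k ^ (2 * (1 / 2) : ℝ) * (T * ‖contCoeff k (logPoly (2 * K ^ 2) *
        logPoly (2 * K ^ 2) * star (logPoly (2 * K ^ 2)))‖) ^ 2 ≤
      C * (‖Hs.ofContinuous (1 / 2) (logPoly (2 * K ^ 2)) (finite_support_logPoly _)‖ ^ 2) ^ 3) :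
    T ^ 2 * (Real.log K - 1) ≤ 2048 * |C| := by
  set L := Real.log K with hL
  have hK1 : 1 ≤ K := by
    -- `Real.log 0 = 0` excludes `K = 0`.
    by_contra h0
    have : K = 0 := by omega
    rw [hL, this] at hK
    norm_num at hK
  -- Each term is at least `m * (T L² / (2m))² = T² L⁴ / (4m)`, and `∑ 1/m` over `(K, K²]` is at
  -- least `L - 1`.
  have hlow : T ^ 2 / 4 * L ^ 4 * (L - 1) ≤ ∑ m ∈ Finset.Ioc K (K ^ 2),
      bracket (nullFreq m) ^ (2 * (1 / 2) : ℝ) * (T * ‖contCoeff (nullFreq m)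
        (logPoly (2 * K ^ 2) * logPoly (2 * K ^ 2) * star (logPoly (2 * K ^ 2)))‖) ^ 2 := by
    calc T ^ 2 / 4 * L ^ 4 * (L - 1)
        ≤ T ^ 2 / 4 * L ^ 4 * ∑ m ∈ Finset.Ioc K (K ^ 2), (m : ℝ)⁻¹ := by
          gcongr
          exact log_sub_one_le_sum_Ioc_inv hK1
      _ ≤ _ := by
          rw [Finset.mul_sum]
          refine Finset.sum_le_sum fun m hm => ?_
          rw [Finset.mem_Ioc] at hm
          have hm1 : 1 ≤ m := by omega
          have hm0 : (0 : ℝ) < m := by exact_mod_cast hm1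
          have h1 := le_norm_contCoeff_cubic_logPoly (K := K) (M := 2 * K ^ 2) hm.1.le
            (by omega) hm1
          have h2 := log_le_sum_inv K hK1
          rw [← hL] at h2
          have h3 : (2 * (m : ℝ))⁻¹ * L ^ 2 ≤ ‖contCoeff (nullFreq m)
              (logPoly (2 * K ^ 2) * logPoly (2 * K ^ 2) * star (logPoly (2 * K ^ 2)))‖ := by
            refine le_trans ?_ h1
            gcongr
          rw [show (2 * (1 / 2) : ℝ) = 1 by norm_num, Real.rpow_one]
          calc T ^ 2 / 4 * L ^ 4 * (m : ℝ)⁻¹ = m * (T * ((2 * (m : ℝ))⁻¹ * L ^ 2)) ^ 2 := by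
                field_simp; norm_num
            _ ≤ _ := by
                gcongr
                · exact (bracket_pos _).le
                · exact le_bracket_nullFreq m
  have hS := h ((Finset.Ioc K (K ^ 2)).image fun n : ℕ => nullFreq n)
  rw [Finset.sum_image fun a _ b _ h => by exact_mod_cast nullFreq_injective h] at hS
  -- `2 * (2 + 2 * L) ≤ 8 * L` because `1 ≤ L`.
  have hup : ‖Hs.ofContinuous (1 / 2) (logPoly (2 * K ^ 2)) (finite_support_logPoly _)‖ ^ 2 ≤
      8 * L := by
    refine (norm_sq_logPoly_le _).trans ?_
    have := sum_inv_two_mul_sq_le hK1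
    rw [← hL] at this
    linarith
  have hfin : T ^ 2 / 4 * L ^ 4 * (L - 1) ≤ |C| * (8 * L) ^ 3 := by
    refine (hlow.trans hS).trans ?_
    gcongr
    exact le_abs_self C
  have hL0 : 0 < L := by linarith
  -- `2048 = 4 * 8 ^ 3`.
  have h5 : L ^ 3 * (L * (T ^ 2 * (L - 1))) ≤ L ^ 3 * (2048 * |C|) := by linarith
  have h6 := le_of_mul_le_mul_left h5 (by positivity)
  have h7 : 0 ≤ T ^ 2 * (L - 1) := mul_nonneg (sq_nonneg T) (by linarith)
  exact (le_mul_of_one_le_left h7 hK).trans h6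

end HNLS

end

theorem theorem1p3 (σ : ℝ) (hσ : σ = 1 ∨ σ = -1) (T : ℝ) (hT : 0 < T)
    (Φ : HNLS.Hs (1 / 2) → C(Set.Icc (0 : ℝ) T, HNLS.Hs (1 / 2)))
    (hΦ : HNLS.ExtendsSmoothFlow σ T (1 / 2) Φ) :
    ¬ ContDiffAt ℝ 3 Φ 0 := by
  intro hreg
  obtain ⟨C, hC⟩ := HNLS.exists_cubic_bound hσ hT Φ hΦ hreg
  have hlog : Filter.Tendsto (fun K : ℕ => Real.log K) Filter.atTop Filter.atTop :=
    Real.tendsto_log_atTop.comp tendsto_natCast_atTop_atTop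
  obtain ⟨K, hK⟩ := (hlog.eventually_ge_atTop (2 + 2048 * |C| / T ^ 2)).exists
  have hnn : 0 ≤ 2048 * |C| / T ^ 2 := by positivity
  have h := HNLS.log_le_of_cubic_bound (C := C) hT (K := K) (by linarith)
    (hC _ (HNLS.finite_support_logPoly _) (HNLS.contDiff_logPoly _)
      (HNLS.logPoly_add_single_zero _) (HNLS.logPoly_add_single_two _))
  have h2 : Real.log K - 1 ≤ 2048 * |C| / T ^ 2 := by
    rw [le_div_iff₀ (by positivity)]
    linarith
  linarith
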